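/- Let $\lambda$ be a singular strong limit cardinal, and suppose that there exists a uniform ultrafilter $U$ over $\lambda^+$ (that is, $|X|=\lambda^+$ for every $X\in U$) that is $(\mathrm{cf}(\lambda),\lambda)$-indecomposable. The latter means that $U$ is $\theta$-indecomposable for every cardinal $\theta$ with $\mathrm{cf}(\lambda)<\theta<\lambda$: for every $B\in U$ and every function $f:B\to\theta$ there is $T\subseteq\theta$ with $|T|<\theta$ and $f^{-1}[T]\in U$. Then for every graph $\mathcal G$ with $|V(\mathcal G)|=\lambda^+$ and every cardinal $\mu$ (finite or infinite): if $\mathrm{chr}(\mathcal H)\le\mu$ for every subgraph $\mathcal H$ of $\mathcal G$ with $|V(\mathcal H)|<\lambda$, then $\mathrm{chr}(\mathcal G)\le\mu^{\mathrm{cf}(\lambda)}$. Here $\mathrm{chr}(\mathcal G)$ denotes the least cardinal $\nu$ for which there is a map $c:V(\mathcal G)\to\nu$ with $c(x)\ne c(y)$ for all adjacent $x,y$. -/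

import Mathlib

open Cardinal Order

universe u

/-- An ultrafilter over `α` is uniform iff each of its members has the same cardinality as `α`. -/
def Ultrafilter.IsUniform {α : Type u} (U : Ultrafilter α) : Prop :=
  ∀ X ∈ U, #X = #α

/-- The positive sets of a filter `D`: the sets that do not belong to the dual ideal of `D`. -/
def Filter.positiveSets {α : Type u} (D : Filter α) : Set (Set α) :=
  {B | Bᶜ ∉ D}

/-- A filter `D` over `α` is `θ`-indecomposable (for an infinite cardinal `θ`) iff for every
`D`-positive set `B` and every function `f : B → θ`, there is a set `T ⊆ θ` with `|T| < θ` whose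
preimage under `f` is `D`-positive. The cardinal `θ` is identified with its initial ordinal. -/
def Filter.IsIndecomposable {α : Type u} (D : Filter α) (θ : Cardinal.{u}) : Prop :=
  ∀ B ∈ D.positiveSets, ∀ f : B → θ.ord.ToType,
    ∃ T : Set θ.ord.ToType, #T < θ ∧ Subtype.val '' (f ⁻¹' T) ∈ D.positiveSets

/-- A filter is `(χ, ν)`-indecomposable iff it is `θ`-indecomposable for every cardinal `θ` with
`χ < θ < ν`. -/
def Filter.IsIndecomposableIoo {α : Type u} (D : Filter α) (χ ν : Cardinal.{u}) : Prop :=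
  ∀ θ ∈ Set.Ioo χ ν, D.IsIndecomposable θ

/-- The chromatic number of a graph as a cardinal: the least cardinal `μ` that admits a good
coloring of the vertices with colors in `μ`. -/
noncomputable def SimpleGraph.chr {V : Type u} (G : SimpleGraph V) : Cardinal.{u} :=
  sInf {μ : Cardinal.{u} | Nonempty (G.Coloring μ.ord.ToType)}

/-! Enumerate the vertices in type $\lambda^+$. Each initial segment is a union of
$\mathrm{cf}(\lambda)$ sets of size $<\lambda$, each colored with $\mu$ colors. Send $v$ to the germ
modulo $U$ of $b\mapsto$ (index of a piece of segment $b$ containing $v$, color of $v$ there).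
Adjacent vertices with equal germs would share a piece and a color at some $b$ above both. By
`Ultrafilter.mk_germ_le` there are at most $(\mathrm{cf}(\lambda)\cdot\mu)^{\mathrm{cf}(\lambda)}$
germs when $\mu<\lambda$. -/

theorem Cardinal.IsStrongLimit.power_lt {c a b : Cardinal.{u}} (hc : c.IsStrongLimit)
    (ha : a < c) (hb : b < c) : a ^ b < c :=
  calc
    a ^ b ≤ (2 ^ a) ^ b := power_le_power_right (cantor a).le
    _ = 2 ^ (a * b) := (power_mul ..).symm
    _ < c := hc.isStrongPrelimit (mul_lt_of_lt hc.aleph0_le ha hb)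

/-- A set of size at most `c` is covered by `cof c` many sets of size less than `c`. -/
theorem Cardinal.exists_cover_of_mk_le (c : Cardinal.{u}) (hc : ℵ₀ ≤ c) :
    ∃ I : Type u, #I = c.ord.cof ∧ ∀ {V : Type u} (X : Set V), #X ≤ c →
      ∃ A : I → Set V, (∀ i, #(A i) < c) ∧ ∀ x ∈ X, ∃ i, x ∈ A i := by
  obtain ⟨s, hs, hcard⟩ := Order.exists_cof_eq c.ord.ToType
  refine ⟨s, by rw [hcard, Ordinal.cof_toType], fun {V} X hX ↦ ?_⟩
  obtain ⟨f⟩ : Nonempty (X ↪ c.ord.ToType) := by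
    rwa [← Cardinal.le_def, mk_ord_toType]
  refine ⟨fun i ↦ Subtype.val '' (f ⁻¹' Set.Iic i.1), fun i ↦ ?_, fun x hx ↦ ?_⟩
  · refine (mk_image_le.trans (mk_preimage_of_injective _ _ f.injective)).trans_lt ?_
    simpa using mk_Iic_lt i.1 (by simp) (by simpa using hc)
  · obtain ⟨a, ha, hle⟩ := hs (f ⟨x, hx⟩)
    exact ⟨⟨a, ha⟩, ⟨x, hx⟩, hle, rfl⟩

theorem Ultrafilter.mem_positiveSets {α : Type u} (U : Ultrafilter α) {B : Set α} :
    B ∈ (U : Filter α).positiveSets ↔ B ∈ U := by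
  simp [Filter.positiveSets, Ultrafilter.compl_notMem_iff]

theorem Ultrafilter.IsUniform.mem_of_mk_compl_lt {α : Type u} {U : Ultrafilter α}
    (hU : U.IsUniform) {B : Set α} (hB : #(Bᶜ : Set α) < #α) : B ∈ U := by
  by_contra h
  exact hB.ne (hU _ (Ultrafilter.compl_mem_iff_notMem.2 h))

/-- A function with fewer than `ν` values is, modulo a `(χ, ν)`-indecomposable ultrafilter, a
function with at most `χ` values. -/
theorem Ultrafilter.exists_mk_le_preimage_mem {α : Type u} {U : Ultrafilter α}
    {χ ν : Cardinal.{u}} (hU : (U : Filter α).IsIndecomposableIoo χ ν) {β : Type u}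
    (hβ : #β < ν) (F : α → β) : ∃ T : Set β, #T ≤ χ ∧ F ⁻¹' T ∈ U := by
  suffices H : ∀ κ : Cardinal.{u}, ∀ T : Set β, #T = κ → F ⁻¹' T ∈ U →
      ∃ T : Set β, #T ≤ χ ∧ F ⁻¹' T ∈ U from H _ Set.univ rfl Filter.univ_mem
  intro κ
  induction κ using WellFoundedLT.induction with
  | ind κ ih =>
    rintro T rfl hT
    by_cases hχ : #T ≤ χ
    · exact ⟨T, hχ, hT⟩
    obtain ⟨e⟩ : Nonempty (T ≃ (#T).ord.ToType) := by
      rw [← Cardinal.eq, mk_ord_toType]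
    -- Indecomposability at $\theta=|T|$ itself shrinks $T$ strictly, so the descent ends at size at
    -- most $\chi$.
    obtain ⟨S, hS, hmem⟩ := hU #T ⟨not_le.1 hχ, (mk_set_le T).trans_lt hβ⟩ (F ⁻¹' T)
      (U.mem_positiveSets.2 hT) (fun x ↦ e ⟨F x, x.2⟩)
    have hle : #(Subtype.val '' (e ⁻¹' S) : Set β) < #T :=
      (mk_image_le.trans (mk_preimage_of_injective _ _ e.injective)).trans_lt hS
    refine ih _ hle _ rfl (Filter.mem_of_superset (U.mem_positiveSets.1 hmem) ?_)
    rintro _ ⟨x, hx, rfl⟩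
    exact ⟨⟨F x, x.2⟩, hx, rfl⟩

/-- The ultrapower of a small set by a `(χ, ν)`-indecomposable ultrafilter is small. -/
theorem Ultrafilter.mk_germ_le {α : Type u} {U : Ultrafilter α} {χ ν : Cardinal.{u}}
    (hν : ν.IsStrongLimit) (hχ : χ < ν) (hU : (U : Filter α).IsIndecomposableIoo χ ν)
    {β : Type u} [Nonempty β] (hβ : #β < ν) : #((U : Filter α).Germ β) ≤ #β ^ χ := by
  by_contra! hlt
  obtain ⟨S, hS⟩ := le_mk_iff_exists_set.1 (succ_le_of_lt hlt)
  have hSν : #S < ν := hS ▸ hν.isSuccLimit.succ_lt (hν.power_lt hβ hχ)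
  -- Evaluate representatives of all germs in $S$ simultaneously: modulo $U$ only $\chi$ evaluation
  -- vectors occur, so a germ in $S$ is determined by its entries in those vectors.
  obtain ⟨T, hT, hmem⟩ := exists_mk_le_preimage_mem hU (β := S → β)
    (by simpa using hν.power_lt hβ hSν) (fun x s ↦ s.1.out x)
  have hinj : Function.Injective (fun (s : S) (t : T) ↦ t.1 s) := by
    intro s s' h
    have hs : (s.1.out : α → β) =ᶠ[(U : Filter α)] s'.1.out :=
      Filter.mem_of_superset hmem fun x hx ↦ congrFun h ⟨_, hx⟩
    apply Subtype.ext
    rw [← Quotient.out_eq s.1, ← Quotient.out_eq s'.1]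
    exact Quotient.sound hs
  have hle := mk_le_of_injective hinj
  rw [hS, ← power_def] at hle
  exact (lt_succ _).not_ge
    (hle.trans (power_le_power_left (mk_ne_zero β) hT))

namespace SimpleGraph

theorem chr_le_mk_of_coloring {V C : Type u} {G : SimpleGraph V} (c : G.Coloring C) :
    G.chr ≤ #C := by
  obtain ⟨e⟩ : Nonempty (C ≃ (#C).ord.ToType) := by
    rw [← Cardinal.eq, mk_ord_toType]
  exact csInf_le' ⟨Coloring.mk (fun v ↦ e (c v)) fun h h' ↦ c.valid h (e.injective h')⟩

theorem chr_le_mk {V : Type u} (G : SimpleGraph V) : G.chr ≤ #V :=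
  chr_le_mk_of_coloring G.selfColoring

theorem exists_coloring_of_chr_le {V C : Type u} {G : SimpleGraph V} (h : G.chr ≤ #C) :
    Nonempty (G.Coloring C) := by
  obtain ⟨e⟩ : Nonempty (V ≃ (#V).ord.ToType) := by
    rw [← Cardinal.eq, mk_ord_toType]
  have hmem : G.chr ∈ {μ : Cardinal.{u} | Nonempty (G.Coloring μ.ord.ToType)} :=
    csInf_mem ⟨#V, ⟨Coloring.mk e fun h h' ↦ G.ne_of_adj h (e.injective h')⟩⟩
  obtain ⟨c⟩ := hmem
  obtain ⟨f⟩ : Nonempty (G.chr.ord.ToType ↪ C) := by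
    rwa [← Cardinal.le_def, mk_ord_toType]
  exact ⟨Coloring.mk (fun v ↦ f (c v)) fun h h' ↦ c.valid h (f.injective h')⟩

theorem exists_partial_coloring {V C : Type u} [Nonempty C] {G : SimpleGraph V} {s : Set V}
    (h : ((⊤ : G.Subgraph).induce s).coe.chr ≤ #C) :
    ∃ c : V → C, ∀ v ∈ s, ∀ w ∈ s, G.Adj v w → c v ≠ c w := by
  classical
  obtain ⟨c⟩ := exists_coloring_of_chr_le h
  refine ⟨fun v ↦ if hv : v ∈ s then c ⟨v, hv⟩ else Classical.arbitrary C,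
    fun v hv w hw hvw ↦ ?_⟩
  simp only [hv, hw, dif_pos]
  exact c.valid (by simp [hv, hw, hvw])

end SimpleGraph

theorem mainTheorem4 (lam : Cardinal.{u}) (hsing : lam.IsSingular) (hlim : lam.IsStrongLimit)
    (hU : ∃ U : Ultrafilter (succ lam).ord.ToType,
      U.IsUniform ∧ (U : Filter (succ lam).ord.ToType).IsIndecomposableIoo lam.ord.cof lam)
    (V : Type u) (G : SimpleGraph V) (hG : #V = succ lam) (μ : Cardinal.{u})
    (hsub : ∀ H : G.Subgraph, #H.verts < lam → H.coe.chr ≤ μ) :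
    G.chr ≤ μ ^ lam.ord.cof := by
  obtain ⟨U, hunif, hind⟩ := hU
  have hω := hlim.aleph0_le
  have hcof : ℵ₀ ≤ lam.ord.cof := 
    Ordinal.aleph0_le_cof_iff.2 (Ordinal.one_lt_cof_iff.2 (isSuccLimit_ord hω))
  -- For $\mu\ge\lambda$, König's $\lambda<\lambda^{\mathrm{cf}(\lambda)}$ suffices.
  rcases le_or_gt lam μ with hμ | hμ
  · calc
      G.chr ≤ succ lam := hG ▸ G.chr_le_mk
      _ ≤ lam ^ lam.ord.cof := succ_le_of_lt (lt_power_cof_ord hω)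
      _ ≤ μ ^ lam.ord.cof := power_le_power_right hμ
  obtain ⟨C, rfl⟩ : ∃ C : Type u, #C = μ := ⟨μ.out, mk_out μ⟩
  have hV : Nonempty V := mk_ne_zero_iff.1 (hG ▸ (succ_ne_bot lam))
  obtain ⟨v₀⟩ := hV
  have hC : Nonempty C := by
    obtain ⟨c⟩ := SimpleGraph.exists_coloring_of_chr_le
      (hsub ((⊤ : G.Subgraph).induce {v₀}) (by simpa using one_lt_aleph0.trans_le hω))
    exact ⟨c ⟨v₀, by simp⟩⟩
  have hpart (s : Set V) (hs : #s < lam) :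
      ∃ c : V → C, ∀ v ∈ s, ∀ w ∈ s, G.Adj v w → c v ≠ c w :=
    SimpleGraph.exists_partial_coloring (hsub ((⊤ : G.Subgraph).induce s) (by simpa using hs))
  -- With one color there are no edges; otherwise $\mu\ge2$ lets $\mu^{\mathrm{cf}(\lambda)}$ absorb
  -- $2^{\mathrm{cf}(\lambda)}$ at the end.
  rcases subsingleton_or_nontrivial C with hsubs | hnt
  · have hC1 : #C = 1 := Cardinal.eq_one_iff_unique.2 ⟨hsubs, hC⟩
    rw [hC1, one_power, ← hC1]
    refine SimpleGraph.chr_le_mk_of_coloring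
      (SimpleGraph.Coloring.mk (fun _ ↦ Classical.arbitrary C) fun {v w} hvw ↦ ?_)
    obtain ⟨c, hc⟩ := hpart {v, w} ((lt_aleph0_of_finite _).trans_le hω)
    exact absurd (Subsingleton.elim _ _) (hc v (by simp) w (by simp) hvw)
  obtain ⟨I, hI, hcover⟩ := Cardinal.exists_cover_of_mk_le lam hω
  have hIne : Nonempty I := mk_ne_zero_iff.1 (hI ▸ (aleph0_pos.trans_le hcof).ne')
  obtain ⟨e⟩ : Nonempty (V ≃ (succ lam).ord.ToType) := by
    rw [← Cardinal.eq, mk_ord_toType, hG]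
  have hseg (b : (succ lam).ord.ToType) : #(e ⁻¹' Set.Iio b) ≤ lam := by
    refine (mk_preimage_of_injective _ _ e.injective).trans (lt_succ_iff.1 ?_)
    simpa using mk_Iio_lt b (by simp)
  choose A hA hAmem using fun b ↦ hcover _ (hseg b)
  choose c hc using fun b i ↦ hpart (A b i) (hA b i)
  -- The index is arbitrary when $b$ is not above $v$; by uniformity such $b$ form a $U$-null set.
  have hidx (v : V) (b : (succ lam).ord.ToType) : ∃ i, e v < b → v ∈ A b i := by
    by_cases h : e v < b
    · exact (hAmem b v h).imp fun i hi _ ↦ hi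
    · exact ⟨Classical.arbitrary I, fun h' ↦ absurd h' h⟩
  choose i hi using hidx
  have hlarge (v : V) : ∀ᶠ b in (U : Filter _), e v < b := by
    apply hunif.mem_of_mk_compl_lt
    have := mk_Iic_lt (e v) (by simp) (by simpa using hω.trans (le_succ lam))
    convert this using 3
    ext
    simp
  let col : G.Coloring ((U : Filter (succ lam).ord.ToType).Germ (I × C)) :=
    SimpleGraph.Coloring.mk (fun v ↦ ((fun b ↦ (i v b, c b (i v b) v) : _ → I × C) :
      (U : Filter (succ lam).ord.ToType).Germ (I × C))) fun {v w} hvw heq ↦ by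
        obtain ⟨b, hb, hvb, hwb⟩ :=
          ((Filter.Germ.coe_eq.1 heq).and ((hlarge v).and (hlarge w))).exists
        have hidx : i v b = i w b := congrArg Prod.fst hb
        have hcol : c b (i v b) v = c b (i w b) w := congrArg Prod.snd hb
        rw [← hidx] at hcol
        exact hc b (i v b) v (hi v b hvb) w (hidx ▸ hi w b hwb) hvw hcol
  calc
    G.chr ≤ #((U : Filter (succ lam).ord.ToType).Germ (I × C)) :=
      SimpleGraph.chr_le_mk_of_coloring col
    _ ≤ #(I × C) ^ lam.ord.cof := Ultrafilter.mk_germ_le hlim hsing.cof_ord_lt hind (by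
      simpa [hI] using mul_lt_of_lt hω hsing.cof_ord_lt hμ)
    _ = 2 ^ lam.ord.cof * #C ^ lam.ord.cof := by
      rw [mk_prod, lift_id, lift_id, hI, mul_power, power_self_eq hcof]
    _ ≤ #C ^ lam.ord.cof * #C ^ lam.ord.cof := by
      gcongr
      exact power_le_power_right (Cardinal.two_le_iff_one_lt.2 (one_lt_iff_nontrivial.2 hnt))
    _ = #C ^ lam.ord.cof := by rw [← power_add, add_eq_self hcof]
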